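/- Let $q$ be a prime power and let $1 \le k \le m$ be integers. A Delsarte code is an $\mathbb F_q$-linear subspace $\mathcal C \subseteq \mathrm{Mat}(k\times m,\mathbb F_q)$; its dual is $\mathcal C^\perp := \{N \in \mathrm{Mat}(k\times m,\mathbb F_q) : \mathrm{Tr}(MN^t)=0 \text{ for all } M\in\mathcal C\}$. Write $\mathrm{maxrk}(\mathcal C)$ for the largest rank of a matrix in $\mathcal C$. A Delsarte code $\mathcal A$ is an optimal anticode if $\dim_{\mathbb F_q}(\mathcal A) = m\cdot \mathrm{maxrk}(\mathcal A)$. For a non-zero Delsarte code $\mathcal C$ of dimension $t$ and $1\le r\le t$, the $r$-th Delsarte generalized weight of $\mathcal C$ is $$a_r(\mathcal C) := \frac1m \min\{\dim_{\mathbb F_q}(\mathcal A) : \mathcal A \subseteq \mathrm{Mat}(k\times m,\mathbb F_q) \text{ an optimal anticode with } \dim_{\mathbb F_q}(\mathcal A\cap\mathcal C)\ge r\}.$$ For $s\in\mathbb Z$ put $$W_s(\mathcal C) := \{a_{s+im}(\mathcal C) : i\in\mathbb Z,\ 1\le s+im\le t\},\qquad \overline W_s(\mathcal C) := \{k+1-a_{s+im}(\mathcal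 C) : i\in\mathbb Z,\ 1\le s+im\le t\}.$$ Let $\mathcal C \subseteq \mathrm{Mat}(k\times m,\mathbb F_q)$ be a Delsarte code of dimension $1\le t\le km-1$. For every integer $1\le p\le m$ we have $$W_p(\mathcal C^\perp) = \{1,\dots,k\}\setminus \overline W_{p+t}(\mathcal C).$$ In particular, the Delsarte generalized weights of $\mathcal C$ completely determine those of $\mathcal C^\perp$: if $\mathcal D \subseteq \mathrm{Mat}(k\times m,\mathbb F_q)$ is a Delsarte code with the same sequence of generalized weights $(a_1,\dots,a_t)$ as $\mathcal C$, then $\mathcal D^\perp$ has the same sequence of generalized weights $(a_1,\dots,a_{km-t})$ as $\mathcal C^\perp$. -/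

import Mathlib

namespace Delsarte

open Matrix Module

variable {F : Type*} [Field F] {k m : ℕ}

/-- A Delsarte rank-metric code of size `k × m` over `F`: a linear subspace of the
space of `k × m` matrices over `F`. -/
abbrev Code (F : Type*) [Field F] (k m : ℕ) : Type _ :=
  Submodule F (Matrix (Fin k) (Fin m) F)

/-- The maximum rank of a code (a maximum over a nonempty set of naturals bounded by `k`). -/
noncomputable def maxrk (C : Code F k m) : ℕ :=
  sSup {r : ℕ | ∃ M ∈ C, M.rank = r}

/-- Delsarte optimal anticodes: the codes with `dim A = m * maxrk A`. -/
def IsOptimalAnticode (A : Code F k m) : Prop :=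
  finrank F A = m * maxrk A

/-- The dimensions of the optimal anticodes that meet `C` in dimension at least `r`. -/
def anticodeDims (C : Code F k m) (r : ℕ) : Set ℕ :=
  {d : ℕ | ∃ A : Code F k m, IsOptimalAnticode A ∧ r ≤ finrank F (A ⊓ C : Code F k m) ∧
    finrank F A = d}

/-- The `r`-th Delsarte generalized weight `a_r(C)`, used for `1 ≤ r ≤ dim C`:
`1 / m` times the least dimension of an optimal anticode that meets `C` in dimension at least `r`.
The division by `m` is exact, see `mul_weight`. -/
noncomputable def weight (C : Code F k m) (r : ℕ) : ℕ :=
  sInf (anticodeDims C r) / m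

/-- The division in the definition of `weight` is exact. -/
theorem mul_weight (C : Code F k m) (r : ℕ) :
    m * weight C r = sInf (anticodeDims C r) := by
  refine Nat.mul_div_cancel' ?_
  rcases (anticodeDims C r).eq_empty_or_nonempty with h | h
  · simp [h]
  · obtain ⟨A, hA, -, hd⟩ := Nat.sInf_mem h
    rw [← hd, hA]
    exact dvd_mul_right _ _

/-- The sequence `(a_1(C), …, a_t(C))`, where `t = dim C`, of all Delsarte generalized weights. -/
noncomputable def weights (C : Code F k m) : List ℕ :=
  (List.range (finrank F C)).map fun i => weight C (i + 1)

/-- The trace-product `⟨M, N⟩ = Tr (M Nᵗ)`. -/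
def traceProduct (M N : Matrix (Fin k) (Fin m) F) : F :=
  (M * Nᵀ).trace

/-- The dual code: all matrices whose trace-product with every element of `C` vanishes. -/
def dual (C : Code F k m) : Code F k m where
  carrier := {N | ∀ M ∈ C, traceProduct M N = 0}
  zero_mem' := by
    intro M _
    simp [traceProduct]
  add_mem' := by
    intro N N' hN hN' M hM
    have h1 := hN M hM
    have h2 := hN' M hM
    simp only [traceProduct] at h1 h2 ⊢
    rw [transpose_add, Matrix.mul_add, trace_add, h1, h2, add_zero]
  smul_mem' := by
    intro c N hN M hM
    have h1 := hN M hM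
    simp only [traceProduct] at h1 ⊢
    rw [transpose_smul, Matrix.mul_smul, trace_smul, h1, smul_zero]

/-- The `s`-weight set `W_s(C) = {a_{s+im}(C) : i ∈ ℤ, 1 ≤ s+im ≤ dim C}`. -/
def weightSet (s : ℤ) (C : Code F k m) : Set ℤ :=
  {w : ℤ | ∃ i : ℤ, 1 ≤ s + i * m ∧ s + i * m ≤ finrank F C ∧
    w = weight C (s + i * m).toNat}

/-- The reflected `s`-weight set
`{k + 1 - a_{s+im}(C) : i ∈ ℤ, 1 ≤ s+im ≤ dim C}`. -/
def reflectedWeightSet (s : ℤ) (C : Code F k m) : Set ℤ :=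
  {w : ℤ | ∃ i : ℤ, 1 ≤ s + i * m ∧ s + i * m ≤ finrank F C ∧
    w = (k : ℤ) + 1 - weight C (s + i * m).toNat}

end Delsarte

/-! Write g(R), the `profile` of C, for the largest dimension of A ∩ C over optimal anticodes A of
dimension mR. By `weight_le_iff`, a_r(C) ≤ R iff r ≤ g(R), so weights and profile determine each
other, and R + 1 ∈ W_s(C) iff the class of s modulo m meets the interval (g(R), g(R+1)]. Duals of
optimal anticodes are optimal anticodes. Together with A⊥ ∩ C⊥ = (A + C)⊥ this gives `profile_dual`:
g⊥(k-R) = km - mR - t + g(R). If k = n + l + 1, the interval of C⊥ at n + 1 is therefore, up to a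
shift by t and a multiple of m, (g(l+1), g(l) + m], the complement of (g(l), g(l+1)] in a window of
length m. The class of p + t meets exactly one of the two. The hard input is the classification of
optimal anticodes, `eq_colCode_or_eq_rowCode`. Filter A by the number of vanishing initial rows; the
dimensions d_i of the leading row spaces add up to dim A. A greedy transversal of these spaces is
realized as independent rows of one matrix, so the rank bound and Hall's theorem control the d_i.
Equality in the anticode bound leaves two patterns, which yield a fixed column space or, for k = m,
a fixed row space. -/

namespace Delsarte

open Matrix Module

variable {F : Type*} [Field F] {k m r : ℕ}

/-! ### Greedy extension of independent families -/

section Independence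

variable {ι E : Type*} [AddCommGroup E] [Module F E]

/-- Changing one vector of an independent family to a new vector outside the span of the others. -/
theorem linearIndepOn_update_insert [DecidableEq ι] {v : ι → E} {s : Set ι} {i : ι} (hi : i ∉ s)
    (hv : LinearIndepOn F v s) {x : E} (hx : x ∉ Submodule.span F (v '' s)) :
    LinearIndepOn F (Function.update v i x) (insert i s) := by
  have hEq : Set.EqOn v (Function.update v i x) s := by
    intro j hj
    rw [Function.update_of_ne]
    rintro rfl
    exact hi hj
  rw [linearIndepOn_insert hi]
  refine ⟨hv.congr hEq, ?_⟩
  rwa [← hEq.image_eq, Function.update_self]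

theorem not_le_span_image_of_card_lt [FiniteDimensional F E] (v : ι → E) (s : Finset ι)
    {V : Submodule F E} (h : s.card < finrank F V) :
    ¬ V ≤ Submodule.span F (v '' (s : Set ι)) := by
  classical
  intro hle
  have h1 := Submodule.finrank_mono hle
  have h2 : finrank F (Submodule.span F (v '' (s : Set ι))) ≤ s.card := by
    rw [← Finset.coe_image]
    exact (finrank_span_finset_le_card _).trans Finset.card_image_le
  omega

/-- An independent partial transversal of large enough subspaces can be enlarged greedily. -/
theorem exists_linearIndepOn_union [DecidableEq ι] [FiniteDimensional F E] (V : ι → Submodule F E)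
    (v : ι → E) (s t : Finset ι) (hst : Disjoint s t) (hv : LinearIndepOn F v (s : Set ι))
    (ht : ∀ i ∈ t, s.card + t.card ≤ finrank F (V i)) :
    ∃ w : ι → E, (∀ i ∈ s, w i = v i) ∧ (∀ i ∈ t, w i ∈ V i) ∧
      LinearIndepOn F w ((s ∪ t : Finset ι) : Set ι) := by
  induction t using Finset.induction_on with
  | empty => exact ⟨v, by simp, by simp, by simpa using hv⟩
  | insert a t ha ih =>
    have hat := Finset.disjoint_insert_right.mp hst
    obtain ⟨w, hw1, hw2, hw3⟩ := ih hat.2 fun i hi => by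
      have := ht i (Finset.mem_insert_of_mem hi)
      rw [Finset.card_insert_of_notMem ha] at this
      omega
    have hc := ht a (Finset.mem_insert_self a t)
    rw [Finset.card_insert_of_notMem ha] at hc
    have hlt : (s ∪ t).card < finrank F (V a) := by
      have := Finset.card_union_le s t
      omega
    obtain ⟨x, hxV, hx⟩ := Set.not_subset.mp (not_le_span_image_of_card_lt w _ hlt)
    have hna : a ∉ ((s ∪ t : Finset ι) : Set ι) := by simp [ha, hat.1]
    refine ⟨Function.update w a x, ?_, ?_, ?_⟩
    · intro i hi
      rw [Function.update_of_ne, hw1 i hi]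
      rintro rfl
      exact hat.1 hi
    · intro i hi
      rcases Finset.mem_insert.mp hi with rfl | hi
      · simpa using hxV
      · have hia : i ≠ a := fun h => ha (h ▸ hi)
        rw [Function.update_of_ne hia]
        exact hw2 i hi
    · have := linearIndepOn_update_insert hna hw3 hx
      rwa [Finset.union_insert, Finset.coe_insert]

end Independence

/-! ### Filtration by initial zero rows, and matrices of large rank -/

section LeadingRows

/-- The matrices of `A` whose first `n` rows vanish. -/
def vanishingRows (A : Code F k m) (n : ℕ) : Code F k m where
  carrier := {M | M ∈ A ∧ ∀ j : Fin k, (j : ℕ) < n → M.row j = 0}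
  zero_mem' := ⟨A.zero_mem, fun _ _ => rfl⟩
  add_mem' := fun hM hN => ⟨A.add_mem hM.1 hN.1, fun j hj => by
    have h1 := hM.2 j hj
    have h2 := hN.2 j hj
    ext l
    simpa using congrArg₂ (· + ·) (congrFun h1 l) (congrFun h2 l)⟩
  smul_mem' := fun c M hM => ⟨A.smul_mem c hM.1, fun j hj => by
    ext l
    simpa using Or.inr (congrFun (hM.2 j hj) l)⟩

theorem mem_vanishingRows {A : Code F k m} {n : ℕ} {M : Matrix (Fin k) (Fin m) F} :
    M ∈ vanishingRows A n ↔ M ∈ A ∧ ∀ j : Fin k, (j : ℕ) < n → M.row j = 0 := Iff.rfl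

/-- The `i`-th row as a linear map. -/
def rowMap (i : Fin k) : Matrix (Fin k) (Fin m) F →ₗ[F] (Fin m → F) where
  toFun M := M.row i
  map_add' _ _ := rfl
  map_smul' _ _ := rfl

@[simp] theorem rowMap_apply (i : Fin k) (M : Matrix (Fin k) (Fin m) F) :
    rowMap i M = M.row i := rfl

/-- The `i`-th rows of the matrices of `A` whose previous rows vanish. -/
def leadingRows (A : Code F k m) (i : Fin k) : Submodule F (Fin m → F) :=
  (vanishingRows A i).map (rowMap i)

theorem mem_leadingRows {A : Code F k m} {i : Fin k} {M : Matrix (Fin k) (Fin m) F}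
    (hM : M ∈ vanishingRows A i) : M.row i ∈ leadingRows A i :=
  ⟨M, hM, rfl⟩

theorem vanishingRows_zero (A : Code F k m) : vanishingRows A 0 = A := by
  ext M
  simp [mem_vanishingRows]

theorem vanishingRows_top (A : Code F k m) : vanishingRows A k = ⊥ := by
  ext M
  rw [mem_vanishingRows, Submodule.mem_bot]
  constructor
  · rintro ⟨-, h⟩
    ext i j
    exact congrFun (h i i.2) j
  · rintro rfl
    exact ⟨A.zero_mem, fun _ _ => rfl⟩

theorem mem_vanishingRows_succ {A : Code F k m} {i : Fin k} {M : Matrix (Fin k) (Fin m) F} :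
    M ∈ vanishingRows A (i + 1) ↔ M ∈ vanishingRows A i ∧ M.row i = 0 := by
  simp only [mem_vanishingRows]
  constructor
  · rintro ⟨h1, h2⟩
    exact ⟨⟨h1, fun j hj => h2 j (by omega)⟩, h2 i (by omega)⟩
  · rintro ⟨⟨h1, h2⟩, h3⟩
    refine ⟨h1, fun j hj => ?_⟩
    rcases Nat.lt_succ_iff_lt_or_eq.mp hj with h | h
    · exact h2 j h
    · rwa [Fin.ext h]

theorem finrank_vanishingRows (A : Code F k m) (i : Fin k) :
    finrank F (vanishingRows A i) =
      finrank F (leadingRows A i) + finrank F (vanishingRows A (i + 1)) := by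
  have hker : (LinearMap.ker ((rowMap i).domRestrict (vanishingRows A i))).map
      (vanishingRows A i).subtype = vanishingRows A (i + 1) := by
    ext M
    rw [mem_vanishingRows_succ]
    simp only [Submodule.mem_map, LinearMap.mem_ker, Submodule.subtype_apply, Subtype.exists]
    constructor
    · rintro ⟨N, hN, h1, rfl⟩
      exact ⟨hN, h1⟩
    · rintro ⟨h1, h2⟩
      exact ⟨M, h1, h2, rfl⟩
  rw [← hker, Submodule.finrank_map_subtype_eq, leadingRows, ← LinearMap.range_domRestrict,
    LinearMap.finrank_range_add_finrank_ker]

/-- Rank-nullity for each row map identifies the quotients of the filtration, and the dimensions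
telescope. -/
theorem sum_finrank_leadingRows (A : Code F k m) :
    ∑ i, finrank F (leadingRows A i) = finrank F A := by
  have key : ∀ n ≤ k, (∑ j ∈ Finset.range n,
      if h : j < k then finrank F (leadingRows A ⟨j, h⟩) else 0) +
        finrank F (vanishingRows A n) = finrank F A := by
    intro n
    induction n with
    | zero =>
      intro _
      rw [vanishingRows_zero, Finset.sum_range_zero, zero_add]
    | succ n ih =>
      intro hn
      have h1 := ih (by omega)
      have h2 := finrank_vanishingRows A ⟨n, hn⟩
      rw [Finset.sum_range_succ, dif_pos (show n < k by omega)]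
      dsimp only at h2
      omega
  have := key k le_rfl
  rw [vanishingRows_top, finrank_bot, add_zero] at this
  rw [Finset.sum_fin_eq_sum_range, this]

/-- Matrices with independent rows in the positions `I` have rank at least `#I`. -/
theorem card_le_rank_of_linearIndepOn {M : Matrix (Fin k) (Fin m) F} {I : Finset (Fin k)}
    (h : LinearIndepOn F M.row (I : Set (Fin k))) : I.card ≤ M.rank := by
  have h1 : LinearIndependent F (M.submatrix (fun i : I => (i : Fin k)) id).row := h
  have h2 := h1.rank_matrix
  rw [Fintype.card_coe] at h2
  rw [← h2]
  have h3 : M.submatrix (fun i : I => (i : Fin k)) id =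
      (1 : Matrix (Fin k) (Fin k) F).submatrix (fun i : I => (i : Fin k)) id * M := by
    ext i j
    simp [Matrix.mul_apply, Matrix.one_apply]
  rw [h3]
  exact rank_mul_le_right _ _

/-- An independent transversal of the leading row spaces is realized by the rank of a single
matrix of the code. -/
theorem exists_card_le_rank {A : Code F k m} {v : Fin k → Fin m → F} {I : Finset (Fin k)}
    (hvI : ∀ i ∈ I, v i ∈ leadingRows A i) (hv : LinearIndepOn F v (I : Set (Fin k))) :
    ∃ M ∈ A, I.card ≤ M.rank := by
  -- The vectors `v i` are traded for rows of a matrix of `A` one position at a time; the mixed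
  -- family stays independent on `I`.
  suffices key : ∀ n ≤ k, ∃ M ∈ A,
      LinearIndepOn F (fun i : Fin k => if (i : ℕ) < n then M.row i else v i)
        (I : Set (Fin k)) by
    obtain ⟨M, hM, h⟩ := key k le_rfl
    refine ⟨M, hM, card_le_rank_of_linearIndepOn ?_⟩
    simpa using h
  intro n
  induction n with
  | zero => exact fun _ => ⟨0, A.zero_mem, by simpa using hv⟩
  | succ n ih =>
    intro hn
    obtain ⟨M, hM, h⟩ := ih (by omega)
    set a : Fin k := ⟨n, hn⟩ with ha
    set g : Fin k → Fin m → F := fun i => if (i : ℕ) < n then M.row i else v i with hg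
    have hga : g a = v a := by simp [hg, ha]
    have hlt : ∀ i : Fin k, i ≠ a → ((i : ℕ) < n + 1 ↔ (i : ℕ) < n) := by
      intro i hi
      have : (i : ℕ) ≠ n := fun h => hi (Fin.ext h)
      omega
    by_cases haI : a ∈ I
    · obtain ⟨N, hN, hNa⟩ := hvI a haI
      rw [rowMap_apply] at hNa
      have hIa : (I : Set (Fin k)) = insert a ((I.erase a : Finset (Fin k)) : Set (Fin k)) := by
        rw [← Finset.coe_insert, Finset.insert_erase haI]
      have hna : a ∉ ((I.erase a : Finset (Fin k)) : Set (Fin k)) := by simp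
      rw [hIa, linearIndepOn_insert hna, hga] at h
      -- If both c = 0 and c = 1 failed, `v a` would lie in the span of the others. Two scalars
      -- suffice, so any field will do.
      have hx : ∃ c : F, M.row a + c • v a ∉
          Submodule.span F (g '' ((I.erase a : Finset (Fin k)) : Set (Fin k))) := by
        by_contra! hcon
        have h0 := hcon 0
        have h1 := hcon 1
        rw [zero_smul, add_zero] at h0
        rw [one_smul] at h1
        exact h.2 (((Submodule.add_mem_iff_right _ h0)).mp h1)
      obtain ⟨c, hc⟩ := hx
      -- `N` vanishes in the rows before `a`, so the rows already placed do not change.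
      refine ⟨M + c • N, A.add_mem hM (A.smul_mem c hN.1), ?_⟩
      rw [hIa]
      refine (linearIndepOn_update_insert hna h.1 hc).congr ?_
      intro i _
      dsimp only
      by_cases hi : i = a
      · subst hi
        rw [Function.update_self, if_pos (by simp [ha]), ← hNa]
        rfl
      · rw [Function.update_of_ne hi]
        simp only [hg, hlt i hi]
        split_ifs with hin
        · have := hN.2 i hin
          ext l
          have h5 : N i l = 0 := congrFun this l
          simp [h5]
        · rfl
    · refine ⟨M, hM, h.congr ?_⟩
      intro i hi
      have hia : i ≠ a := by
        rintro rfl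
        exact haI hi
      simp only [hg, hlt i hia]

end LeadingRows

/-! ### Combinatorics of the dimensions of the leading row spaces -/

section Counting

/-- Hall's condition fails for some set s of thresholds. The sets {i : l < d i} decrease in l, so
only l = min s matters, and s has at most R + 1 - l elements. Hence b = l and a = R - l. -/
theorem exists_card_filter_le {R : ℕ} (d : Fin k → ℕ)
    (h : ¬ ∃ σ : Fin (R + 1) → Fin k, Function.Injective σ ∧ ∀ l : Fin (R + 1), (l : ℕ) < d (σ l)) :
    ∃ a b, a + b = R ∧ (Finset.univ.filter fun i => b < d i).card ≤ a := by
  have hall := (Finset.all_card_le_biUnion_card_iff_exists_injective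
    (fun l : Fin (R + 1) => Finset.univ.filter fun i => (l : ℕ) < d i)).not.mpr
      (by simpa using h)
  push Not at hall
  obtain ⟨s, hs⟩ := hall
  have hne : s.Nonempty := Finset.card_pos.mp (by omega)
  set l := s.min' hne with hl
  have h1 : (Finset.univ.filter fun i => (l : ℕ) < d i) ⊆
      s.biUnion (fun l : Fin (R + 1) => Finset.univ.filter fun i => (l : ℕ) < d i) :=
    Finset.subset_biUnion_of_mem
      (fun l : Fin (R + 1) => Finset.univ.filter fun i => (l : ℕ) < d i) (s.min'_mem hne)
  have h2 : s ⊆ Finset.Ici l := fun x hx => Finset.mem_Ici.mpr (s.min'_le x hx)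
  have h3 := Finset.card_le_card h1
  have h4 := Finset.card_le_card h2
  rw [Fin.card_Ici] at h4
  have := l.2
  exact ⟨R - l, l, by omega, by omega⟩

/-- Bound d i by m above the threshold b and by b elsewhere: the sum is at most am + kb ≤ m(a + b).
Equality forces every bound to be sharp; b = 0 gives the values m and 0, while b > 0 forces k = m, a
= 0 and b = R. -/
theorem sum_le_of_card_filter_le {R a b : ℕ} (hkm : k ≤ m) (d : Fin k → ℕ) (hd : ∀ i, d i ≤ m)
    (hab : a + b = R) (hc : (Finset.univ.filter fun i => b < d i).card ≤ a) :
    ∑ i, d i ≤ m * R ∧ (0 < m → m * R ≤ ∑ i, d i →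
      ((Finset.univ.filter fun i => d i = m).card = R ∧ ∀ i, d i = m ∨ d i = 0) ∨
      (k = m ∧ ∀ i, d i = R)) := by
  set c := (Finset.univ.filter fun i => b < d i).card with hcdef
  set c' := (Finset.univ.filter fun i => ¬ b < d i).card with hcdef'
  have hcc : c + c' = k := by
    have := Finset.card_filter_add_card_filter_not (s := (Finset.univ : Finset (Fin k)))
      (fun i => b < d i)
    rwa [Finset.card_univ, Fintype.card_fin] at this
  have hle : ∀ i ∈ Finset.univ, d i ≤ if b < d i then m else b := by
    intro i _
    split_ifs with h
    · exact hd i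
    · omega
  have hsum : ∑ i, (if b < d i then m else b) = c * m + c' * b := by
    rw [Finset.sum_ite, Finset.sum_const, Finset.sum_const, smul_eq_mul, smul_eq_mul]
  have h1 : c * m ≤ a * m := Nat.mul_le_mul_right _ hc
  have h2 : c' * b ≤ m * b := Nat.mul_le_mul_right _ (by omega)
  have h3 : m * R = a * m + m * b := by rw [← hab]; ring
  have h4 := Finset.sum_le_sum hle
  refine ⟨by omega, fun hm hge => ?_⟩
  have h5 : c * m = a * m := by omega
  have h6 : c' * b = m * b := by omega
  have hca : c = a := Nat.eq_of_mul_eq_mul_right hm h5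
  have h7 := (Finset.sum_eq_sum_iff_of_le hle).mp (by omega)
  rcases Nat.eq_zero_or_pos b with hb | hb
  · left
    have h8 : ∀ i, d i = m ∨ d i = 0 := by
      intro i
      have := h7 i (Finset.mem_univ i)
      split_ifs at this <;> omega
    refine ⟨?_, h8⟩
    rw [← hab, hb, add_zero, ← hca, hcdef]
    congr 1
    ext i
    have := h8 i
    simp only [Finset.mem_filter, Finset.mem_univ, true_and]
    omega
  · right
    have hcm : c' = m := Nat.eq_of_mul_eq_mul_right hb h6
    refine ⟨by omega, fun i => ?_⟩
    have h9 : (Finset.univ.filter fun i => b < d i) = ∅ := Finset.card_eq_zero.mp (by omega)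
    have := h7 i (Finset.mem_univ i)
    rw [if_neg] at this
    · omega
    · intro h
      have : i ∈ (Finset.univ.filter fun i => b < d i) := by simpa using h
      rw [h9] at this
      simp at this

end Counting

/-! ### The anticode bound and its equality cases -/

section MaximumRank

theorem rank_le_maxrk {A : Code F k m} {M : Matrix (Fin k) (Fin m) F} (hM : M ∈ A) :
    M.rank ≤ maxrk A := by
  refine le_csSup ⟨k, ?_⟩ ⟨M, hM, rfl⟩
  rintro r ⟨N, -, rfl⟩
  exact rank_le_height N

theorem maxrk_le {A : Code F k m} {r : ℕ} (h : ∀ M ∈ A, M.rank ≤ r) : maxrk A ≤ r := by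
  refine csSup_le' ?_
  rintro _ ⟨M, hM, rfl⟩
  exact h M hM

theorem maxrk_le_height (A : Code F k m) : maxrk A ≤ k :=
  maxrk_le fun M _ => rank_le_height M

/-- At stage l at most l vectors have been chosen, so a space of dimension above l contains a vector
outside their span. The finished transversal would yield a matrix of rank at least R + 1. -/
theorem no_increasing_transversal {A : Code F k m} {R : ℕ} (hR : ∀ M ∈ A, M.rank ≤ R) :
    ¬ ∃ σ : Fin (R + 1) → Fin k, Function.Injective σ ∧
      ∀ l : Fin (R + 1), (l : ℕ) < finrank F (leadingRows A (σ l)) := by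
  rintro ⟨σ, hσ, hd⟩
  suffices key : ∀ n ≤ R + 1, ∃ (v : Fin k → Fin m → F),
      (∀ i ∈ (Finset.univ.filter fun l : Fin (R + 1) => (l : ℕ) < n).image σ,
        v i ∈ leadingRows A i) ∧ LinearIndepOn F v
        (((Finset.univ.filter fun l : Fin (R + 1) => (l : ℕ) < n).image σ : Finset (Fin k)) :
          Set (Fin k)) by
    obtain ⟨v, hv1, hv2⟩ := key (R + 1) le_rfl
    obtain ⟨M, hM, hc⟩ := exists_card_le_rank hv1 hv2
    rw [Finset.card_image_of_injective _ hσ, Finset.filter_true_of_mem fun l _ => l.2,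
      Finset.card_univ, Fintype.card_fin] at hc
    have := hR M hM
    omega
  intro n
  induction n with
  | zero => exact fun _ => ⟨0, by simp, by simp⟩
  | succ n ih =>
    intro hn
    obtain ⟨v, hv1, hv2⟩ := ih (by omega)
    set a : Fin (R + 1) := ⟨n, by omega⟩ with ha
    have hset : (Finset.univ.filter fun l : Fin (R + 1) => (l : ℕ) < n + 1) =
        insert a (Finset.univ.filter fun l : Fin (R + 1) => (l : ℕ) < n) := by
      ext l
      simp [Fin.ext_iff, ha]
      omega
    set I := (Finset.univ.filter fun l : Fin (R + 1) => (l : ℕ) < n).image σ with hI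
    have hna : σ a ∉ I := by
      intro h
      obtain ⟨l, hl, he⟩ := Finset.mem_image.mp h
      have := hσ he
      subst this
      simp [ha] at hl
    have hcard : I.card ≤ n := by
      refine Finset.card_image_le.trans ?_
      rw [Fin.card_filter_val_lt]
      exact min_le_right _ _
    have hlt : I.card < finrank F (leadingRows A (σ a)) := hcard.trans_lt (hd a)
    obtain ⟨x, hxV, hx⟩ := Set.not_subset.mp (not_le_span_image_of_card_lt v _ hlt)
    refine ⟨Function.update v (σ a) x, ?_, ?_⟩
    · rw [hset, Finset.image_insert]
      intro i hi
      by_cases hia : i = σ a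
      · subst hia
        simpa using hxV
      · rw [Function.update_of_ne hia]
        exact hv1 i (Finset.mem_of_mem_insert_of_ne hi hia)
    · rw [hset, Finset.image_insert, Finset.coe_insert]
      exact linearIndepOn_update_insert (by simpa using hna) hv2 hx

theorem finrank_leadingRows_le (A : Code F k m) (i : Fin k) :
    finrank F (leadingRows A i) ≤ m := by
  simpa using (leadingRows A i).finrank_le

/-- The anticode bound. -/
theorem finrank_le_mul {A : Code F k m} (hkm : k ≤ m) {R : ℕ} (hR : ∀ M ∈ A, M.rank ≤ R) :
    finrank F A ≤ m * R := by
  obtain ⟨a, b, hab, hc⟩ := exists_card_filter_le (fun i => finrank F (leadingRows A i))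
    (no_increasing_transversal hR)
  rw [← sum_finrank_leadingRows]
  exact (sum_le_of_card_filter_le hkm _ (finrank_leadingRows_le A) hab hc).1

theorem leadingRows_of_mul_le_finrank {A : Code F k m} (hkm : k ≤ m) (hm : 0 < m) {R : ℕ}
    (hR : ∀ M ∈ A, M.rank ≤ R) (hA : m * R ≤ finrank F A) :
    ((Finset.univ.filter fun i => finrank F (leadingRows A i) = m).card = R ∧
      ∀ i, finrank F (leadingRows A i) = m ∨ finrank F (leadingRows A i) = 0) ∨
    (k = m ∧ ∀ i, finrank F (leadingRows A i) = R) := by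
  obtain ⟨a, b, hab, hc⟩ := exists_card_filter_le (fun i => finrank F (leadingRows A i))
    (no_increasing_transversal hR)
  rw [← sum_finrank_leadingRows] at hA
  exact (sum_le_of_card_filter_le hkm _ (finrank_leadingRows_le A) hab hc).2 hm hA

/-- The anticode bound squeezes dim A between mR and m · `maxrk A`, so optimality follows without
computing the maximum rank. -/
theorem isOptimalAnticode_of_rank_le {A : Code F k m} (hkm : k ≤ m) {R : ℕ}
    (hR : ∀ M ∈ A, M.rank ≤ R) (hA : m * R ≤ finrank F A) : IsOptimalAnticode A := by
  have h1 := finrank_le_mul hkm (A := A) fun M hM => rank_le_maxrk hM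
  have h2 := Nat.mul_le_mul_left m (maxrk_le hR)
  unfold IsOptimalAnticode
  omega

end MaximumRank

/-! ### Linear maps that send independent families into their span -/

section Collinear

variable {ι E : Type*} [AddCommGroup E] [Module F E] [FiniteDimensional F E] [Fintype ι]
  [DecidableEq ι]

/-- Otherwise some hyperplane ker g contains z but not its image y. Two independent families inside
ker g that differ by z in position i have ψ-values in ker g, and these differ by y. -/
theorem not_linearIndependent_of_mem_span (hι : Fintype.card ι < finrank F E)
    (ψ : (ι → E) →ₗ[F] E)
    (hψ : ∀ x : ι → E, LinearIndependent F x → ψ x ∈ Submodule.span F (Set.range x))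
    (i : ι) (z : E) :
    ¬ LinearIndependent F ![z, (ψ ∘ₗ LinearMap.single F (fun _ => E) i) z] := by
  intro hli
  have hz : z ≠ 0 := hli.ne_zero 0
  have hy : (ψ ∘ₗ LinearMap.single F (fun _ => E) i) z ∉ Submodule.span F {z} := by
    intro h
    obtain ⟨c, hc⟩ := Submodule.mem_span_singleton.mp h
    have := (LinearIndependent.pair_iff.mp hli) c (-1) (by rw [hc]; simp)
    simp at this
  obtain ⟨g, hgy, hg⟩ := Submodule.exists_le_ker_of_notMem hy
  have hgz : z ∈ LinearMap.ker g := hg (Submodule.mem_span_singleton_self z)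
  refine hgy (LinearMap.mem_ker.mp ?_)
  have hker : Fintype.card ι ≤ finrank F (LinearMap.ker g) := by
    have h1 := LinearMap.finrank_range_add_finrank_ker g
    have h2 := (LinearMap.range g).finrank_le
    rw [finrank_self] at h2
    omega
  have hψker : ∀ x : ι → E, LinearIndependent F x → (∀ j, x j ∈ LinearMap.ker g) →
      ψ x ∈ LinearMap.ker g := fun x hx hxg =>
    (Submodule.span_le.mpr (Set.range_subset_iff.mpr hxg)) (hψ x hx)
  by_cases hl : ∃ l, l ≠ i
  · obtain ⟨l, hli⟩ := hl
    obtain ⟨w, hw1, hw2, hw3⟩ := exists_linearIndepOn_union (F := F)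
      (fun _ : ι => LinearMap.ker g) (fun _ => z) {l} (Finset.univ.erase l) (by simp)
      (by simpa using hz) (by
        intro _ _
        rw [Finset.card_singleton, Finset.card_erase_of_mem (Finset.mem_univ l),
          Finset.card_univ]
        have := Fintype.card_pos_iff.mpr ⟨l⟩
        omega)
    have hwl : w l = z := hw1 l (by simp)
    have huniv : (({l} ∪ Finset.univ.erase l : Finset ι) : Set ι) = Set.univ := by
      ext j
      by_cases j = l <;> simp_all
    rw [huniv] at hw3
    have hwg : ∀ j, w j ∈ LinearMap.ker g := by
      intro j
      by_cases hj : j = l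
      · rwa [hj, hwl]
      · exact hw2 j (by simp [hj])
    have hins : (Set.univ : Set ι) = insert i {i}ᶜ := by
      ext j
      simp [em]
    -- Since z = `w l` with l ≠ i, adding z to `w i` preserves independence.
    have hnot : w i + z ∉ Submodule.span F (w '' {i}ᶜ) := by
      rw [hins, linearIndepOn_insert (by simp)] at hw3
      intro h
      refine hw3.2 ((Submodule.add_mem_iff_left _ ?_).mp h)
      exact hwl ▸ Submodule.subset_span ⟨l, by simpa using hli, rfl⟩
    have hw4 : LinearIndependent F (Function.update w i (w i + z)) := by
      rw [← linearIndepOn_univ_iff, hins]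
      refine linearIndepOn_update_insert (by simp) ?_ hnot
      exact hw3.mono (Set.subset_univ _)
    have hupd : Function.update w i (w i + z) =
        w + LinearMap.single F (fun _ => E) i z := by
      ext j
      by_cases hj : j = i
      · subst hj
        simp
      · simp [hj]
    have h1 := hψker w (linearIndepOn_univ_iff.mp hw3) hwg
    have h2 := hψker _ hw4 (by
      intro j
      by_cases hj : j = i
      · subst hj
        simpa using Submodule.add_mem _ (hwg j) hgz
      · simpa [hj] using hwg j)
    rw [hupd, map_add] at h2
    exact (Submodule.add_mem_iff_right _ h1).mp h2
  -- With a single index, the family consisting of z alone is independent and lies in the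
  -- hyperplane.
  · push Not at hl
    have : Unique ι := ⟨⟨i⟩, hl⟩
    have hs : LinearMap.single F (fun _ => E) i z = fun _ => z := by
      ext j
      rw [hl j]
      simp
    rw [LinearMap.comp_apply, hs]
    refine hψker _ ?_ fun _ => hgz
    rw [linearIndependent_unique_iff]
    exact hz

/-- A linear map sending every independent family to its span is a fixed linear combination. -/
theorem exists_eq_sum_smul_of_mem_span (hι : Fintype.card ι < finrank F E)
    (ψ : (ι → E) →ₗ[F] E)
    (hψ : ∀ x : ι → E, LinearIndependent F x → ψ x ∈ Submodule.span F (Set.range x)) :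
    ∃ t : ι → F, ∀ x, ψ x = ∑ i, t i • x i := by
  choose t ht using fun i => LinearMap.exists_eq_smul_id_of_forall_notLinearIndependent
    (not_linearIndependent_of_mem_span hι ψ hψ i)
  refine ⟨t, fun x => ?_⟩
  conv_lhs => rw [← LinearMap.sum_single_apply (fun _ => E) x]
  rw [map_sum]
  exact Finset.sum_congr rfl fun i _ => LinearMap.congr_fun (ht i) (x i)

end Collinear

/-! ### Classification of optimal anticodes -/

/-- The matrices whose columns lie in the column space of `T`. -/
def colCode (m : ℕ) (T : Matrix (Fin k) (Fin r) F) : Code F k m :=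
  LinearMap.range (mulLeftLinearMap (Fin m) F T)

/-- The matrices whose rows lie in the row space of `T`. -/
def rowCode (k : ℕ) (T : Matrix (Fin r) (Fin m) F) : Code F k m :=
  LinearMap.range (mulRightLinearMap (Fin k) F T)

theorem mem_colCode {T : Matrix (Fin k) (Fin r) F} {M : Matrix (Fin k) (Fin m) F} :
    M ∈ colCode m T ↔ ∃ X : Matrix (Fin r) (Fin m) F, T * X = M := Iff.rfl

theorem mem_rowCode {T : Matrix (Fin r) (Fin m) F} {M : Matrix (Fin k) (Fin m) F} :
    M ∈ rowCode k T ↔ ∃ X : Matrix (Fin k) (Fin r) F, X * T = M := Iff.rfl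

theorem rank_le_of_mem_colCode {T : Matrix (Fin k) (Fin r) F} {M : Matrix (Fin k) (Fin m) F}
    (hM : M ∈ colCode m T) : M.rank ≤ r := by
  obtain ⟨X, rfl⟩ := mem_colCode.mp hM
  exact (rank_mul_le_right _ _).trans (rank_le_height X)

theorem rank_le_of_mem_rowCode {T : Matrix (Fin r) (Fin m) F} {M : Matrix (Fin k) (Fin m) F}
    (hM : M ∈ rowCode k T) : M.rank ≤ r := by
  obtain ⟨X, rfl⟩ := mem_rowCode.mp hM
  exact (rank_mul_le_right _ _).trans (rank_le_height T)

theorem finrank_colCode {T : Matrix (Fin k) (Fin r) F} {P : Matrix (Fin r) (Fin k) F}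
    (h : P * T = 1) : finrank F (colCode m T) = m * r := by
  rw [colCode, LinearMap.finrank_range_of_inj, Module.finrank_matrix]
  · simp [mul_comm]
  · intro X Y hXY
    have : P * (T * X) = P * (T * Y) := congrArg (P * ·) hXY
    simpa [← Matrix.mul_assoc, h] using this

theorem finrank_rowCode {T : Matrix (Fin r) (Fin m) F} {P : Matrix (Fin m) (Fin r) F}
    (h : T * P = 1) : finrank F (rowCode k T) = k * r := by
  rw [rowCode, LinearMap.finrank_range_of_inj, Module.finrank_matrix]
  · simp
  · intro X Y hXY
    have : X * T * P = Y * T * P := congrArg (· * P) hXY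
    simpa [Matrix.mul_assoc, h] using this

/-- A code of bounded rank which is a graph over the matrices with `r` rows is a `colCode`. -/
theorem exists_eq_colCode {A : Code F k m} (hrm : r < m) (P : Matrix (Fin r) (Fin k) F)
    (hP : ∀ M ∈ A, P * M = 0 → M = 0) (hA : finrank F A = m * r)
    (hrank : ∀ M ∈ A, M.rank ≤ r) :
    ∃ T : Matrix (Fin k) (Fin r) F, P * T = 1 ∧ A = colCode m T := by
  let f : A →ₗ[F] Matrix (Fin r) (Fin m) F := (mulLeftLinearMap (Fin m) F P).domRestrict A
  have hf : Function.Injective f := by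
    rw [← LinearMap.ker_eq_bot, LinearMap.ker_eq_bot']
    rintro ⟨M, hM⟩ h
    exact Subtype.ext (hP M hM h)
  let e : A ≃ₗ[F] Matrix (Fin r) (Fin m) F := f.linearEquivOfInjective hf (by
    rw [hA, Module.finrank_matrix]
    simp [mul_comm])
  have he : ∀ X, P * (e.symm X : Matrix (Fin k) (Fin m) F) = X := fun X => e.apply_symm_apply X
  have hrow : ∀ j : Fin k, ∃ t : Fin r → F, ∀ X : Matrix (Fin r) (Fin m) F,
      (e.symm X : Matrix (Fin k) (Fin m) F).row j = ∑ i, t i • X.row i := by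
    intro j
    have hspan : ∀ x : Fin r → Fin m → F, LinearIndependent F x →
        (rowMap j ∘ₗ A.subtype ∘ₗ e.symm.toLinearMap ∘ₗ (Matrix.ofLinearEquiv F).toLinearMap) x ∈
          Submodule.span F (Set.range x) := by
      intro x hx
      set Y : Matrix (Fin k) (Fin m) F := (e.symm (Matrix.of x) : Matrix (Fin k) (Fin m) F)
        with hY
      have hPY : P * Y = Matrix.of x := he _
      -- P Y = X puts the row space of X inside that of Y. It has dimension r, the rank bound for Y,
      -- so the two coincide and every row of Y lies in the span of x.
      have h1 : Submodule.span F (Set.range x) ≤ Submodule.span F (Set.range Y.row) := by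
        rw [Submodule.span_le]
        rintro _ ⟨i, rfl⟩
        have : x i = ∑ l, P i l • Y.row l := by
          ext c
          have := congrFun (congrFun hPY i) c
          rw [Matrix.mul_apply] at this
          simpa using this.symm
        rw [this]
        exact Submodule.sum_mem _ fun l _ =>
          Submodule.smul_mem _ _ (Submodule.subset_span ⟨l, rfl⟩)
      have h2 : finrank F (Submodule.span F (Set.range Y.row)) ≤
          finrank F (Submodule.span F (Set.range x)) := by
        rw [← rank_eq_finrank_span_row, finrank_span_eq_card hx, Fintype.card_fin]
        exact hrank _ (e.symm _).2
      rw [Submodule.eq_of_le_of_finrank_le h1 h2]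
      exact Submodule.subset_span ⟨j, rfl⟩
    obtain ⟨t, ht⟩ := exists_eq_sum_smul_of_mem_span (by simpa) _ hspan
    exact ⟨t, fun X => ht X⟩
  choose t ht using hrow
  have hT : ∀ X, (e.symm X : Matrix (Fin k) (Fin m) F) = Matrix.of t * X := by
    intro X
    ext j c
    have := congrFun (ht j X) c
    rw [Matrix.mul_apply]
    simpa using this
  refine ⟨Matrix.of t, ?_, ?_⟩
  · ext a b
    have h := he (Matrix.single b ⟨0, by omega⟩ 1)
    rw [hT, ← Matrix.mul_assoc] at h
    have h1 := congrFun (congrFun h a) ⟨0, by omega⟩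
    simpa [Matrix.one_apply, Matrix.single_apply, eq_comm] using h1
  · ext M
    rw [mem_colCode]
    constructor
    · intro hM
      refine ⟨P * M, ?_⟩
      rw [← hT]
      exact congrArg Subtype.val (e.symm_apply_apply ⟨M, hM⟩)
    · rintro ⟨X, rfl⟩
      rw [← hT]
      exact (e.symm X).2

/-- This is `exists_eq_colCode` applied to the transposed code. -/
theorem exists_eq_rowCode {A : Code F k m} (hrk : r < k) (Q : Matrix (Fin m) (Fin r) F)
    (hQ : ∀ M ∈ A, M * Q = 0 → M = 0) (hA : finrank F A = k * r)
    (hrank : ∀ M ∈ A, M.rank ≤ r) :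
    ∃ T : Matrix (Fin r) (Fin m) F, T * Q = 1 ∧ A = rowCode k T := by
  let τ := transposeLinearEquiv (Fin k) (Fin m) F F
  have hmem : ∀ N, N ∈ A.map τ.toLinearMap ↔ Nᵀ ∈ A := by
    intro N
    rw [Submodule.mem_map]
    constructor
    · rintro ⟨M, hM, rfl⟩
      exact hM
    · intro h
      exact ⟨Nᵀ, h, rfl⟩
  have h1 : ∀ N ∈ A.map τ.toLinearMap, Qᵀ * N = 0 → N = 0 := by
    intro N hN h
    have := hQ _ ((hmem N).mp hN) (by
      have := congrArg transpose h
      simpa [transpose_mul] using this)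
    simpa using congrArg transpose this
  have h2 : finrank F (A.map τ.toLinearMap) = k * r := by
    rw [← hA]
    exact LinearEquiv.finrank_map_eq τ A
  have h3 : ∀ N ∈ A.map τ.toLinearMap, N.rank ≤ r := by
    intro N hN
    rw [← rank_transpose]
    exact hrank _ ((hmem N).mp hN)
  obtain ⟨T, hT1, hT2⟩ := exists_eq_colCode hrk Qᵀ h1 h2 h3
  refine ⟨Tᵀ, ?_, ?_⟩
  · have := congrArg transpose hT1
    simpa [transpose_mul] using this
  · ext M
    have h1 := hmem Mᵀ
    rw [transpose_transpose, hT2, mem_colCode] at h1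
    rw [← h1, mem_rowCode]
    constructor
    · rintro ⟨X, hX⟩
      exact ⟨Xᵀ, by rw [← transpose_mul, hX, transpose_transpose]⟩
    · rintro ⟨X, hX⟩
      exact ⟨Xᵀ, by rw [← hX, transpose_mul, transpose_transpose]⟩

/-- A matrix of `A` vanishes if its rows vanish as soon as they are leading rows. -/
theorem eq_zero_of_leadingRows {A : Code F k m} {M : Matrix (Fin k) (Fin m) F} (hM : M ∈ A)
    (h : ∀ i, M.row i ∈ leadingRows A i → M.row i = 0) : M = 0 := by
  have key : ∀ n ≤ k, M ∈ vanishingRows A n := by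
    intro n
    induction n with
    | zero =>
      intro _
      rwa [vanishingRows_zero]
    | succ n ih =>
      intro hn
      have hMn := ih (by omega)
      exact (mem_vanishingRows_succ (i := ⟨n, hn⟩)).mpr ⟨hMn, h _ (mem_leadingRows hMn)⟩
  have := key k le_rfl
  rwa [vanishingRows_top, Submodule.mem_bot] at this

/-- If x lay in space i but not in space j, extend x to R independent vectors using R - 1 positions
other than i and j. Their span contains x, so it differs from space j, which has the same dimension
and hence supplies an (R+1)-st independent vector, against the rank bound. -/
theorem leadingRows_le_of_finrank_eq {A : Code F k m} {R : ℕ} (hRk : R < k)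
    (hR : ∀ M ∈ A, M.rank ≤ R) (h : ∀ i, finrank F (leadingRows A i) = R) (i j : Fin k) :
    leadingRows A i ≤ leadingRows A j := by
  classical
  intro x hxi
  by_contra hxj
  have hij : i ≠ j := by
    rintro rfl
    exact hxj hxi
  have hx0 : x ≠ 0 := by
    rintro rfl
    exact hxj (Submodule.zero_mem _)
  have hR0 : 0 < R := by
    by_contra h0
    have h1 : leadingRows A i = ⊥ := Submodule.finrank_eq_zero.mp (by rw [h]; omega)
    rw [h1, Submodule.mem_bot] at hxi
    exact hx0 hxi
  obtain ⟨t, htsub, htcard⟩ := Finset.exists_subset_card_eq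
    (s := (Finset.univ.erase i).erase j) (n := R - 1) (by
      rw [Finset.card_erase_of_mem (by simp [hij.symm]), Finset.card_erase_of_mem (by simp),
        Finset.card_univ, Fintype.card_fin]
      omega)
  have hit : i ∉ t := fun hi => by simpa using htsub hi
  have hjt : j ∉ t := fun hj => by simpa using htsub hj
  obtain ⟨w, hw1, hw2, hw3⟩ := exists_linearIndepOn_union (F := F) (leadingRows A)
    (fun _ => x) {i} t (by simpa using hit) (by simpa using hx0) (by
      intro l _
      rw [h, htcard, Finset.card_singleton]
      omega)
  have hwi : w i = x := hw1 i (by simp)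
  have hcard : ({i} ∪ t).card = R := by
    rw [Finset.card_union_of_disjoint (by simpa using hit), htcard, Finset.card_singleton]
    omega
  have hjnot : j ∉ (({i} ∪ t : Finset (Fin k)) : Set (Fin k)) := by
    simp [hij.symm, hjt]
  have hnot : ¬ leadingRows A j ≤
      Submodule.span F (w '' (({i} ∪ t : Finset (Fin k)) : Set (Fin k))) := by
    intro hle
    have heq := Submodule.eq_of_le_of_finrank_le hle (by
      rw [h, ← hcard, ← Finset.coe_image]
      exact (finrank_span_finset_le_card _).trans Finset.card_image_le)
    refine hxj ?_
    rw [heq, ← hwi]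
    exact Submodule.subset_span ⟨i, by simp, rfl⟩
  obtain ⟨y, hyV, hy⟩ := Set.not_subset.mp hnot
  have hind := linearIndepOn_update_insert hjnot hw3 hy
  rw [← Finset.coe_insert] at hind
  obtain ⟨M, hM, hc⟩ := exists_card_le_rank (A := A) (by
    intro l hl
    by_cases hlj : l = j
    · subst hlj
      simpa using hyV
    · rw [Function.update_of_ne hlj]
      have hl' := Finset.mem_of_mem_insert_of_ne hl hlj
      rcases Finset.mem_union.mp hl' with h1 | h1
      · rw [Finset.mem_singleton.mp h1, hwi]
        exact hxi
      · exact hw2 l h1) hind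
  rw [Finset.card_insert_of_notMem (by simpa using hjnot), hcard] at hc
  have := hR M hM
  omega

/-- The optimal anticodes are the codes of all matrices with column space (or, for square
matrices, row space) in a fixed subspace. -/
theorem IsOptimalAnticode.eq_colCode_or_eq_rowCode {A : Code F k m} (hA : IsOptimalAnticode A)
    (hkm : k ≤ m) (hm : 0 < m) :
    (∃ (r : ℕ) (T : Matrix (Fin k) (Fin r) F) (P : Matrix (Fin r) (Fin k) F),
      P * T = 1 ∧ A = colCode m T) ∨
    (k = m ∧ ∃ (r : ℕ) (T : Matrix (Fin r) (Fin m) F) (P : Matrix (Fin m) (Fin r) F),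
      T * P = 1 ∧ A = rowCode k T) := by
  have hR : ∀ M ∈ A, M.rank ≤ maxrk A := fun M hM => rank_le_maxrk hM
  have hAR : finrank F A = m * maxrk A := hA
  have hRk := maxrk_le_height A
  set R := maxrk A
  rcases Nat.lt_or_ge R m with hRm | hRm
  · rcases leadingRows_of_mul_le_finrank hkm hm hR hAR.ge with ⟨hcard, hd⟩ | ⟨hkm', hd⟩
    · left
      -- P selects the rows in `I`. Outside `I` the leading row spaces are zero, so a matrix of `A`
      -- is determined by these rows.
      set I := Finset.univ.filter fun i => finrank F (leadingRows A i) = m with hI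
      obtain ⟨T, hT⟩ := exists_eq_colCode hRm
        ((1 : Matrix (Fin k) (Fin k) F).submatrix (I.orderEmbOfFin hcard) id) (by
          intro M hM hPM
          refine eq_zero_of_leadingRows hM fun i hi => ?_
          rcases hd i with h | h
          · have hiI : i ∈ Set.range (I.orderEmbOfFin hcard) := by
              rw [Finset.range_orderEmbOfFin]
              simpa [hI] using h
            obtain ⟨l, rfl⟩ := hiI
            ext c
            have := congrFun (congrFun hPM l) c
            simpa [Matrix.mul_apply, Matrix.one_apply] using this
          · rw [Submodule.finrank_eq_zero.mp h, Submodule.mem_bot] at hi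
            exact hi) hAR hR
      exact ⟨R, T, _, hT⟩
    · right
      refine ⟨hkm', ?_⟩
      let i₀ : Fin k := ⟨0, by omega⟩
      -- All leading row spaces equal this one. A map extending `e` is injective on it, so its
      -- matrix serves as Q.
      let e : leadingRows A i₀ ≃ₗ[F] (Fin R → F) :=
        LinearEquiv.ofFinrankEq _ _ (by rw [hd, finrank_fin_fun])
      obtain ⟨g, hg⟩ := LinearMap.exists_extend e.toLinearMap
      obtain ⟨T, hT⟩ := exists_eq_rowCode (by omega) (LinearMap.toMatrix' g)ᵀ (by
          intro M hM hMQ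
          refine eq_zero_of_leadingRows hM fun i hi => ?_
          have hi₀ := leadingRows_le_of_finrank_eq (by omega) hR hd i i₀ hi
          have h1 : g (M.row i) = 0 := by
            rw [← LinearMap.toMatrix'_mulVec]
            ext c
            have := congrFun (congrFun hMQ i) c
            rw [Matrix.mul_apply] at this
            simpa [Matrix.mulVec, dotProduct, mul_comm] using this
          have h2 : e ⟨M.row i, hi₀⟩ = 0 := by
            rw [← h1]
            exact (LinearMap.congr_fun hg ⟨M.row i, hi₀⟩).symm
          exact congrArg Subtype.val (e.map_eq_zero_iff.mp h2)) (by rw [hAR, hkm']) hR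
      exact ⟨R, T, _, hT⟩
  -- Here R ≤ k ≤ m ≤ R, and `A` is the whole matrix space.
  · left
    refine ⟨k, 1, 1, by simp, ?_⟩
    have h1 : colCode m (1 : Matrix (Fin k) (Fin k) F) = ⊤ := by
      rw [eq_top_iff]
      intro M _
      exact mem_colCode.mpr ⟨M, by simp⟩
    rw [h1]
    refine Submodule.eq_top_of_finrank_eq ?_
    rw [hAR, Module.finrank_matrix]
    have : R = k := by omega
    simp [this, mul_comm]

theorem isOptimalAnticode_colCode {T : Matrix (Fin k) (Fin r) F} {P : Matrix (Fin r) (Fin k) F}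
    (h : P * T = 1) (hkm : k ≤ m) : IsOptimalAnticode (colCode m T) :=
  isOptimalAnticode_of_rank_le hkm (fun _ hM => rank_le_of_mem_colCode hM) (finrank_colCode h).ge

theorem isOptimalAnticode_rowCode {T : Matrix (Fin r) (Fin m) F} {P : Matrix (Fin m) (Fin r) F}
    (h : T * P = 1) (hkm : k = m) : IsOptimalAnticode (rowCode k T) :=
  isOptimalAnticode_of_rank_le hkm.le (fun _ hM => rank_le_of_mem_rowCode hM)
    (by rw [finrank_rowCode h, hkm])

/-- Every nonzero optimal anticode contains an optimal anticode of the next smaller dimension. -/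
theorem IsOptimalAnticode.exists_le {A : Code F k m} (hA : IsOptimalAnticode A)
    (hkm : k ≤ m) (hm : 0 < m) (hdim : finrank F A = m * (r + 1)) :
    ∃ B ≤ A, IsOptimalAnticode B ∧ finrank F B = m * r := by
  rcases hA.eq_colCode_or_eq_rowCode hkm hm with ⟨s, T, P, hPT, rfl⟩ | ⟨hkm', s, T, P, hTP, rfl⟩
  · rw [finrank_colCode hPT] at hdim
    obtain rfl := Nat.eq_of_mul_eq_mul_left hm hdim
    -- Dropping the last column of T and the last row of P preserves the one-sided inverse.
    have h : P.submatrix Fin.castSucc id * T.submatrix id Fin.castSucc = 1 := by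
      rw [← Matrix.submatrix_mul _ _ _ _ _ Function.bijective_id, hPT,
        Matrix.submatrix_one _ (Fin.castSucc_injective r)]
    refine ⟨colCode m (T.submatrix id Fin.castSucc), ?_, isOptimalAnticode_colCode h hkm,
      finrank_colCode h⟩
    intro M hM
    obtain ⟨X, rfl⟩ := mem_colCode.mp hM
    refine mem_colCode.mpr
      ⟨(1 : Matrix (Fin (r + 1)) (Fin (r + 1)) F).submatrix id Fin.castSucc * X, ?_⟩
    rw [← Matrix.mul_assoc]
    congr 1
    ext i j
    simp [Matrix.mul_apply, Matrix.one_apply]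
  · rw [finrank_rowCode hTP, hkm'] at hdim
    obtain rfl := Nat.eq_of_mul_eq_mul_left hm hdim
    have h : T.submatrix Fin.castSucc id * P.submatrix id Fin.castSucc = 1 := by
      rw [← Matrix.submatrix_mul _ _ _ _ _ Function.bijective_id, hTP,
        Matrix.submatrix_one _ (Fin.castSucc_injective r)]
    refine ⟨rowCode k (T.submatrix Fin.castSucc id), ?_, isOptimalAnticode_rowCode h hkm',
      by rw [finrank_rowCode h, hkm']⟩
    intro M hM
    obtain ⟨X, rfl⟩ := mem_rowCode.mp hM
    refine mem_rowCode.mpr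
      ⟨X * (1 : Matrix (Fin (r + 1)) (Fin (r + 1)) F).submatrix Fin.castSucc id, ?_⟩
    rw [Matrix.mul_assoc]
    congr 1
    ext i j
    simp [Matrix.mul_apply, Matrix.one_apply]

/-! ### Trace duality and duals of optimal anticodes -/

section Duality

/-- The trace-product as a bilinear form. -/
noncomputable def traceForm (F : Type*) [Field F] (k m : ℕ) :
    LinearMap.BilinForm F (Matrix (Fin k) (Fin m) F) :=
  LinearMap.mk₂ F traceProduct
    (by intros; simp [traceProduct, Matrix.add_mul])
    (by intros; simp [traceProduct])
    (by intros; simp [traceProduct, Matrix.mul_add])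
    (by intros; simp [traceProduct])

theorem traceForm_apply (M N : Matrix (Fin k) (Fin m) F) :
    traceForm F k m M N = traceProduct M N := rfl

theorem traceProduct_comm (M N : Matrix (Fin k) (Fin m) F) :
    traceProduct M N = traceProduct N M := by
  rw [traceProduct, ← trace_transpose, transpose_mul, transpose_transpose, traceProduct]

theorem eq_zero_of_traceProduct {M : Matrix (Fin k) (Fin m) F}
    (h : ∀ N, traceProduct M N = 0) : M = 0 := by
  rw [ext_iff_trace_mul_right]
  intro N
  have := h Nᵀ
  simpa [traceProduct] using this

theorem traceForm_nondegenerate : (traceForm F k m).Nondegenerate :=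
  ⟨fun _ h => eq_zero_of_traceProduct h,
    fun _ h => eq_zero_of_traceProduct fun N => (traceProduct_comm _ N).trans (h N)⟩

theorem traceForm_isRefl : (traceForm F k m).IsRefl := fun M N h => by
  rw [traceForm_apply] at h ⊢
  rwa [traceProduct_comm]

theorem dual_eq_orthogonal (C : Code F k m) : dual C = (traceForm F k m).orthogonal C := rfl

theorem dual_dual (C : Code F k m) : dual (dual C) = C := by
  simp only [dual_eq_orthogonal]
  exact LinearMap.BilinForm.orthogonal_orthogonal traceForm_nondegenerate traceForm_isRefl C

theorem finrank_le (C : Code F k m) : finrank F C ≤ k * m := by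
  simpa [Module.finrank_matrix] using C.finrank_le

theorem finrank_add_finrank_dual (C : Code F k m) :
    finrank F C + finrank F (dual C) = k * m := by
  have h1 := finrank_le C
  rw [dual_eq_orthogonal, LinearMap.BilinForm.finrank_orthogonal traceForm_nondegenerate,
    Module.finrank_matrix]
  simp only [Fintype.card_fin, finrank_self, mul_one]
  omega

theorem dual_sup (A C : Code F k m) : dual (A ⊔ C) = dual A ⊓ dual C := by
  ext N
  constructor
  · intro h
    exact ⟨fun M hM => h M (Submodule.mem_sup_left hM), fun M hM => h M (Submodule.mem_sup_right hM)⟩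
  · rintro ⟨h1, h2⟩ M hM
    obtain ⟨X, hX, Y, hY, rfl⟩ := Submodule.mem_sup.mp hM
    have h3 : traceProduct X N = 0 := h1 X hX
    have h4 : traceProduct Y N = 0 := h2 Y hY
    have : traceProduct (X + Y) N = traceProduct X N + traceProduct Y N := by
      simp [traceProduct, Matrix.add_mul]
    rw [this, h3, h4, add_zero]

theorem finrank_dual_inf_dual (A C : Code F k m) :
    finrank F (dual A ⊓ dual C : Code F k m) + finrank F A + finrank F C =
      k * m + finrank F (A ⊓ C : Code F k m) := by
  have h1 := finrank_add_finrank_dual (A ⊔ C)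
  have h2 := Submodule.finrank_sup_add_finrank_inf_eq A C
  rw [dual_sup] at h1
  omega

/-- Left multiplication by T has adjoint left multiplication by Tᵀ, and the form is nondegenerate.
-/
theorem transpose_mul_eq_zero_of_mem_dual {T : Matrix (Fin k) (Fin r) F}
    {N : Matrix (Fin k) (Fin m) F} (hN : N ∈ dual (colCode m T)) : Tᵀ * N = 0 := by
  refine eq_zero_of_traceProduct fun X => ?_
  have h : traceProduct (T * X) N = 0 := hN _ (mem_colCode.mpr ⟨X, rfl⟩)
  rw [traceProduct_comm] at h
  rw [← h, traceProduct, traceProduct, transpose_mul, Matrix.mul_assoc, trace_mul_comm,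
    Matrix.mul_assoc]

theorem mul_transpose_eq_zero_of_mem_dual {T : Matrix (Fin r) (Fin m) F}
    {N : Matrix (Fin k) (Fin m) F} (hN : N ∈ dual (rowCode k T)) : N * Tᵀ = 0 := by
  refine eq_zero_of_traceProduct fun X => ?_
  have h : traceProduct (X * T) N = 0 := hN _ (mem_rowCode.mpr ⟨X, rfl⟩)
  rw [traceProduct_comm] at h
  rw [← h, traceProduct, traceProduct, transpose_mul, Matrix.mul_assoc]

/-- The dual of an optimal anticode is an optimal anticode. -/
theorem IsOptimalAnticode.dual {A : Code F k m} (hA : IsOptimalAnticode A)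
    (hkm : k ≤ m) (hm : 0 < m) : IsOptimalAnticode (dual A) := by
  have hdim := finrank_add_finrank_dual A
  rcases hA.eq_colCode_or_eq_rowCode hkm hm with ⟨r, T, P, hPT, rfl⟩ | ⟨hkm', r, T, P, hTP, rfl⟩
  · rw [finrank_colCode hPT] at hdim
    have hrank : r ≤ T.rank := by
      have := rank_mul_le_right P T
      rwa [hPT, rank_one, Fintype.card_fin] at this
    refine isOptimalAnticode_of_rank_le hkm (R := k - r) (fun N hN => ?_) ?_
    · have := rank_add_rank_le_card_of_mul_eq_zero (transpose_mul_eq_zero_of_mem_dual hN)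
      rw [rank_transpose, Fintype.card_fin] at this
      omega
    · rw [Nat.mul_sub, mul_comm m k]
      omega
  · rw [finrank_rowCode hTP] at hdim
    have hrank : r ≤ T.rank := by
      have := rank_mul_le_left T P
      rwa [hTP, rank_one, Fintype.card_fin] at this
    refine isOptimalAnticode_of_rank_le hkm (R := m - r) (fun N hN => ?_) ?_
    · have := rank_add_rank_le_card_of_mul_eq_zero (mul_transpose_eq_zero_of_mem_dual hN)
      rw [rank_transpose, Fintype.card_fin] at this
      omega
    · subst hkm'
      rw [Nat.mul_sub]
      omega

end Duality

/-! ### The profile of a code and its relation to the weights -/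

section Profile

/-- The largest dimension of the intersection of `C` with an optimal anticode of dimension
`m * R`. -/
noncomputable def profile (C : Code F k m) (R : ℕ) : ℕ :=
  sSup {d | ∃ A : Code F k m, IsOptimalAnticode A ∧ finrank F A = m * R ∧
    finrank F (A ⊓ C : Code F k m) = d}

theorem finrank_inf_le_right (A C : Code F k m) :
    finrank F (A ⊓ C : Code F k m) ≤ finrank F C :=
  Submodule.finrank_mono inf_le_right

theorem finrank_inf_le_profile {A : Code F k m} (C : Code F k m) {R : ℕ}
    (hA : IsOptimalAnticode A) (hdim : finrank F A = m * R) :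
    finrank F (A ⊓ C : Code F k m) ≤ profile C R := by
  refine le_csSup ⟨finrank F C, ?_⟩ ⟨A, hA, hdim, rfl⟩
  rintro _ ⟨B, -, -, rfl⟩
  exact finrank_inf_le_right B C

theorem exists_isOptimalAnticode (F : Type*) [Field F] {k m R : ℕ} (hkm : k ≤ m) (hR : R ≤ k) :
    ∃ A : Code F k m, IsOptimalAnticode A ∧ finrank F A = m * R := by
  have h : (1 : Matrix (Fin k) (Fin k) F).submatrix (Fin.castLE hR) id *
      (1 : Matrix (Fin k) (Fin k) F).submatrix id (Fin.castLE hR) = 1 := by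
    rw [← Matrix.submatrix_mul _ _ _ _ _ Function.bijective_id, Matrix.one_mul,
      Matrix.submatrix_one _ (Fin.castLE_injective hR)]
  exact ⟨_, isOptimalAnticode_colCode h hkm, finrank_colCode h⟩

theorem exists_finrank_inf_eq_profile (C : Code F k m) {R : ℕ} (hkm : k ≤ m) (hR : R ≤ k) :
    ∃ A : Code F k m, IsOptimalAnticode A ∧ finrank F A = m * R ∧
      finrank F (A ⊓ C : Code F k m) = profile C R := by
  obtain ⟨A, hA, hdim⟩ := exists_isOptimalAnticode F hkm hR
  refine Nat.sSup_mem (s := {d | ∃ A : Code F k m, IsOptimalAnticode A ∧ finrank F A = m * R ∧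
    finrank F (A ⊓ C : Code F k m) = d}) ⟨_, A, hA, hdim, rfl⟩ ⟨finrank F C, ?_⟩
  rintro _ ⟨B, -, -, rfl⟩
  exact finrank_inf_le_right B C

theorem profile_le_finrank (C : Code F k m) {R : ℕ} (hkm : k ≤ m) (hR : R ≤ k) :
    profile C R ≤ finrank F C := by
  obtain ⟨A, -, -, h⟩ := exists_finrank_inf_eq_profile C hkm hR
  rw [← h]
  exact finrank_inf_le_right A C

theorem profile_zero (C : Code F k m) (hkm : k ≤ m) : profile C 0 = 0 := by
  obtain ⟨A, -, hdim, h⟩ := exists_finrank_inf_eq_profile C hkm (Nat.zero_le k)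
  have := Submodule.finrank_mono (inf_le_left : A ⊓ C ≤ A)
  omega

theorem profile_self (C : Code F k m) (hkm : k ≤ m) : profile C k = finrank F C := by
  obtain ⟨A, -, hdim, h⟩ := exists_finrank_inf_eq_profile C hkm le_rfl
  have hA : A = ⊤ := Submodule.eq_top_of_finrank_eq (by
    rw [hdim, Module.finrank_matrix]
    simp [mul_comm])
  rw [← h, hA, top_inf_eq]

/-- The dual of an anticode attaining the profile of C is a candidate for the profile of C⊥.
Applying this also to C⊥ gives equality in `profile_dual`. -/
theorem le_profile_dual (C : Code F k m) {R : ℕ} (hkm : k ≤ m) (hm : 0 < m) (hR : R ≤ k) :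
    k * m + profile C R ≤ profile (dual C) (k - R) + m * R + finrank F C := by
  obtain ⟨A, hA, hdim, h⟩ := exists_finrank_inf_eq_profile C hkm hR
  have h1 := finrank_add_finrank_dual A
  have h2 := finrank_dual_inf_dual A C
  have h3 := finrank_inf_le_profile (dual C) (R := k - R) (hA.dual hkm hm) (by
    rw [Nat.mul_sub, mul_comm m k]
    omega)
  omega

theorem profile_dual (C : Code F k m) {R : ℕ} (hkm : k ≤ m) (hm : 0 < m) (hR : R ≤ k) :
    profile (dual C) (k - R) + m * R + finrank F C = k * m + profile C R := by
  have h1 := le_profile_dual C hkm hm hR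
  have h2 := le_profile_dual (dual C) hkm hm (Nat.sub_le k R)
  have h3 := finrank_add_finrank_dual C
  have h4 : m * R ≤ m * k := Nat.mul_le_mul_left m hR
  rw [dual_dual, Nat.sub_sub_self hR, Nat.mul_sub, mul_comm m k] at h2
  rw [mul_comm m k] at h4
  omega

theorem profile_succ_le (C : Code F k m) {R : ℕ} (hkm : k ≤ m) (hm : 0 < m) (hR : R < k) :
    profile C (R + 1) ≤ profile C R + m := by
  obtain ⟨A, hA, hdim, h⟩ := exists_finrank_inf_eq_profile C (R := R + 1) hkm hR
  obtain ⟨B, hBA, hB, hBdim⟩ := hA.exists_le hkm hm hdim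
  have h1 := finrank_inf_le_profile C hB hBdim
  have h2 := Submodule.finrank_sup_add_finrank_inf_eq B (A ⊓ C)
  rw [← inf_assoc, inf_eq_left.mpr hBA] at h2
  have h3 := Submodule.finrank_mono (sup_le hBA inf_le_left : B ⊔ A ⊓ C ≤ A)
  rw [mul_add, mul_one] at hdim
  omega

/-- By `profile_dual`, monotonicity for C is the statement that the profile of C⊥ grows by at most m
per step; no anticode has to be enlarged. -/
theorem profile_le_succ (C : Code F k m) {R : ℕ} (hkm : k ≤ m) (hm : 0 < m) (hR : R < k) :
    profile C R ≤ profile C (R + 1) := by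
  have h1 := profile_dual C hkm hm hR.le
  have h2 := profile_dual C (R := R + 1) hkm hm hR
  have h3 := profile_succ_le (dual C) (R := k - (R + 1)) hkm hm (by omega)
  rw [show k - (R + 1) + 1 = k - R by omega] at h3
  rw [mul_add, mul_one] at h2
  omega

theorem profile_mono (C : Code F k m) {R S : ℕ} (hkm : k ≤ m) (hm : 0 < m) (hRS : R ≤ S)
    (hS : S ≤ k) : profile C R ≤ profile C S := by
  induction S, hRS using Nat.le_induction with
  | base => exact le_rfl
  | succ S _ ih => exact (ih (by omega)).trans (profile_le_succ C hkm hm hS)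

theorem weight_le_iff (C : Code F k m) {R : ℕ} (hkm : k ≤ m) (hm : 0 < m) (hR : R ≤ k)
    (hr : r ≤ finrank F C) : weight C r ≤ R ↔ r ≤ profile C R := by
  constructor
  · intro h
    -- An anticode of full dimension shows that the infimum is attained rather than being the
    -- default value 0 of the empty set.
    obtain ⟨B, hB, hBdim, hBC⟩ := exists_finrank_inf_eq_profile C hkm le_rfl
    rw [profile_self C hkm] at hBC
    obtain ⟨A, hA, hAr, hdim⟩ :=
      Nat.sInf_mem (s := anticodeDims C r) ⟨_, B, hB, by omega, rfl⟩
    rw [← mul_weight] at hdim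
    exact (hAr.trans (finrank_inf_le_profile C hA hdim)).trans (profile_mono C hkm hm h hR)
  · intro h
    obtain ⟨A, hA, hdim, hAC⟩ := exists_finrank_inf_eq_profile C hkm hR
    have h1 : sInf (anticodeDims C r) ≤ m * R := Nat.sInf_le ⟨A, hA, by omega, hdim⟩
    rw [← mul_weight] at h1
    exact Nat.le_of_mul_le_mul_left h1 hm

theorem weight_le_height (C : Code F k m) (hkm : k ≤ m) (hm : 0 < m) (hr : r ≤ finrank F C) :
    weight C r ≤ k := by
  rwa [weight_le_iff C hkm hm le_rfl hr, profile_self C hkm]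

theorem weight_pos (C : Code F k m) (hkm : k ≤ m) (hm : 0 < m) (hr0 : 0 < r)
    (hr : r ≤ finrank F C) : 0 < weight C r := by
  have := weight_le_iff C hkm hm (Nat.zero_le k) hr
  rw [profile_zero C hkm] at this
  omega

end Profile

/-! ### Weight sets as residue classes meeting intervals -/

section WeightSets

theorem weightSet_subset_Icc (C : Code F k m) (hkm : k ≤ m) (hm : 0 < m) (s : ℤ) :
    weightSet s C ⊆ Set.Icc (1 : ℤ) k := by
  rintro w ⟨i, h1, h2, rfl⟩
  have h3 := weight_le_height (r := (s + i * m).toNat) C hkm hm (by omega)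
  have h4 := weight_pos (r := (s + i * m).toNat) C hkm hm (by omega) (by omega)
  exact ⟨by omega, by omega⟩

theorem succ_mem_weightSet_iff (C : Code F k m) (hkm : k ≤ m) (hm : 0 < m) (s : ℤ) {n : ℕ}
    (hn : n < k) : (n + 1 : ℤ) ∈ weightSet s C ↔
      ∃ i : ℤ, profile C n < s + i * m ∧ s + i * m ≤ profile C (n + 1) := by
  constructor
  · rintro ⟨i, h1, h2, h3⟩
    refine ⟨i, ?_⟩
    have h4 := weight_le_iff (r := (s + i * m).toNat) C hkm hm hn.le (by omega)
    have h5 := weight_le_iff (r := (s + i * m).toNat) (R := n + 1) C hkm hm hn (by omega)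
    omega
  · rintro ⟨i, h1, h2⟩
    have h3 := profile_le_finrank C (R := n + 1) hkm hn
    refine ⟨i, by omega, by omega, ?_⟩
    have h4 := weight_le_iff (r := (s + i * m).toNat) C hkm hm hn.le (by omega)
    have h5 := weight_le_iff (r := (s + i * m).toNat) (R := n + 1) C hkm hm hn (by omega)
    omega

theorem mem_reflectedWeightSet_iff (C : Code F k m) (s w : ℤ) :
    w ∈ reflectedWeightSet s C ↔ (k : ℤ) + 1 - w ∈ weightSet s C := by
  constructor
  · rintro ⟨i, h1, h2, rfl⟩
    exact ⟨i, h1, h2, by ring⟩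
  · rintro ⟨i, h1, h2, h3⟩
    exact ⟨i, h1, h2, by linarith⟩

/-- A residue class modulo `m` meets exactly one of the two parts of an interval of length `m`. -/
theorem exists_mem_upper_iff_not_exists_mem_lower {a b q m : ℤ} (hm : 0 < m) :
    (∃ i : ℤ, b < q + i * m ∧ q + i * m ≤ a + m) ↔ ¬ ∃ i : ℤ, a < q + i * m ∧ q + i * m ≤ b := by
  constructor
  · rintro ⟨i, h1, h2⟩ ⟨j, h3, h4⟩
    have h5 : 0 < i - j := by
      by_contra h
      nlinarith
    nlinarith
  · intro h
    have h1 := Int.ediv_mul_le (a + m - q) hm.ne'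
    have h2 := Int.lt_ediv_add_one_mul_self (a + m - q) hm
    rw [add_mul, one_mul] at h2
    -- This is the largest member of the class up to a + m. It exceeds a, so if it were at most b it
    -- would lie in the lower part.
    refine ⟨(a + m - q) / m, ?_, by linarith⟩
    by_contra h3
    exact h ⟨(a + m - q) / m, by linarith, by linarith⟩

theorem weightSet_dual (C : Code F k m) (hkm : k ≤ m) (hm : 0 < m) (p : ℤ) :
    weightSet p (dual C) =
      Set.Icc (1 : ℤ) k \ reflectedWeightSet (p + finrank F C) C := by
  ext w
  by_cases hw : w ∈ Set.Icc (1 : ℤ) k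
  · rw [Set.mem_sdiff, and_iff_right hw, mem_reflectedWeightSet_iff]
    obtain ⟨hw1, hwk⟩ := hw
    obtain ⟨n, rfl⟩ : ∃ n : ℕ, w = n + 1 := ⟨(w - 1).toNat, by omega⟩
    have hn : n < k := by omega
    -- The reflection of n + 1 is l + 1.
    obtain ⟨l, rfl⟩ : ∃ l, k = n + l + 1 := ⟨k - n - 1, by omega⟩
    have hl : ((n + l + 1 : ℕ) : ℤ) + 1 - (n + 1) = (l : ℤ) + 1 := by
      push_cast
      ring
    rw [hl, succ_mem_weightSet_iff _ hkm hm _ hn, succ_mem_weightSet_iff _ hkm hm _ (by omega),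
      ← exists_mem_upper_iff_not_exists_mem_lower (by exact_mod_cast hm)]
    have h1 := profile_dual C (R := l + 1) hkm hm (by omega)
    have h2 := profile_dual C (R := l) hkm hm (by omega)
    rw [show n + l + 1 - (l + 1) = n by omega] at h1
    rw [show n + l + 1 - l = n + 1 by omega] at h2
    zify at h1 h2
    constructor
    · rintro ⟨i, h3, h4⟩
      -- The shift by n absorbs the term km - m(l+1) = mn of `profile_dual`.
      exact ⟨i - n, by linarith, by linarith⟩
    · rintro ⟨i, h3, h4⟩
      exact ⟨i + n, by linarith, by linarith⟩
  · exact iff_of_false (fun h => hw (weightSet_subset_Icc _ hkm hm p h)) fun h => hw h.1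

end WeightSets

/-! ### The weights of a code determine those of its dual -/

section Determination

theorem weights_eq_iff {C D : Code F k m} : weights D = weights C ↔
    finrank F D = finrank F C ∧ ∀ i < finrank F C, weight D (i + 1) = weight C (i + 1) := by
  constructor
  · intro h
    have h1 : finrank F D = finrank F C := by
      simpa [weights] using congrArg List.length h
    refine ⟨h1, fun i hi => ?_⟩
    rw [weights, weights, h1] at h
    exact List.map_inj_left.mp h i (List.mem_range.mpr hi)
  · rintro ⟨h1, h2⟩
    rw [weights, weights, h1]
    exact List.map_inj_left.mpr fun i hi => h2 i (List.mem_range.mp hi)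

/-- For r the profile of C at R, a_r(D) = a_r(C) ≤ R, so r is at most the profile of D at R. -/
theorem profile_le_of_weight_eq {C D : Code F k m} (hkm : k ≤ m) (hm : 0 < m)
    (hdim : finrank F D = finrank F C)
    (h : ∀ i < finrank F C, weight D (i + 1) = weight C (i + 1)) {R : ℕ} (hR : R ≤ k) :
    profile C R ≤ profile D R := by
  have h1 := profile_le_finrank C hkm hR
  rcases Nat.eq_zero_or_pos (profile C R) with h0 | h0
  · omega
  · have h2 := h (profile C R - 1) (by omega)
    rw [Nat.sub_add_cancel h0] at h2
    rw [← weight_le_iff D hkm hm hR (by omega), h2, weight_le_iff C hkm hm hR h1]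

theorem weight_le_of_profile_eq {C D : Code F k m} (hkm : k ≤ m) (hm : 0 < m)
    (h : ∀ R ≤ k, profile D R = profile C R) (hD : r ≤ finrank F D)
    (hC : r ≤ finrank F C) : weight D r ≤ weight C r := by
  have h1 := weight_le_height C hkm hm hC
  rw [weight_le_iff D hkm hm h1 hD, h _ h1, ← weight_le_iff C hkm hm h1 hC]

theorem weights_dual_eq {C D : Code F k m} (hkm : k ≤ m) (hm : 0 < m)
    (h : weights D = weights C) : weights (dual D) = weights (dual C) := by
  obtain ⟨hdim, hw⟩ := weights_eq_iff.mp h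
  have hprofile : ∀ R ≤ k, profile D R = profile C R := fun R hR =>
    le_antisymm
      (profile_le_of_weight_eq hkm hm hdim.symm (fun i hi => (hw i (hdim ▸ hi)).symm) hR)
      (profile_le_of_weight_eq hkm hm hdim hw hR)
  have hdual : ∀ R ≤ k, profile (dual D) R = profile (dual C) R := by
    intro R hR
    have h1 := profile_dual C hkm hm (Nat.sub_le k R)
    have h2 := profile_dual D hkm hm (Nat.sub_le k R)
    rw [Nat.sub_sub_self hR] at h1 h2
    rw [hprofile _ (Nat.sub_le k R)] at h2
    omega
  have h1 := finrank_add_finrank_dual C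
  have h2 := finrank_add_finrank_dual D
  have hdim' : finrank F (dual D) = finrank F (dual C) := by omega
  exact weights_eq_iff.mpr ⟨hdim', fun i hi => le_antisymm
    (weight_le_of_profile_eq hkm hm hdual (by omega) hi)
    (weight_le_of_profile_eq hkm hm (fun R hR => (hdual R hR).symm) hi (by omega))⟩

end Determination

end Delsarte

theorem corollary7p7 {F : Type*} [Field F] [Finite F] (k m t : ℕ)
    (hk : 1 ≤ k) (hkm : k ≤ m) (ht : 1 ≤ t) (htkm : t ≤ k * m - 1)
    (C : Delsarte.Code F k m) (hC : Module.finrank F C = t) :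
    (∀ p : ℤ, 1 ≤ p → p ≤ m →
      Delsarte.weightSet p (Delsarte.dual C) =
        Set.Icc (1 : ℤ) k \ Delsarte.reflectedWeightSet (p + t) C) ∧
    (∀ D : Delsarte.Code F k m, Delsarte.weights D = Delsarte.weights C →
      Delsarte.weights (Delsarte.dual D) = Delsarte.weights (Delsarte.dual C)) := by
  have hm : 0 < m := by omega
  subst hC
  exact ⟨fun p _ _ => Delsarte.weightSet_dual C hkm hm p,
    fun D hD => Delsarte.weights_dual_eq hkm hm hD⟩
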